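/- Let $E : y^2+xy=x^3+x^2-2x$ and $E' : y^2+xy=x^3+x^2+8x+10$ be elliptic curves over $\mathbb{C}$, and let $\phi : E\to E'$ be the $2$-isogeny \[ \phi(x,y)=\left(\frac{x^2-2}{x},\ \frac{x^2y+2x+2y}{x^2}\right), \] where the point at infinity and the point $(0,0)$ of $E$ are sent to the point at infinity of $E'$. There are sequences of points $A_k,B_k\in E(\mathbb{C})$ and $C_k,D_k\in E'(\mathbb{C})$ ($k\ge 1$) such that for every $k\ge 1$ the points $A_k,B_k$ form a basis of $E[2^k]$, that is, they generate $E[2^k]$ and $aA_k+bB_k=0$ with $a,b\in\mathbb{Z}$ implies $2^k\mid a$ and $2^k\mid b$; in the same sense $C_k,D_k$ form a basis of $E'[2^k]$; and \[ \phi(A_k)=C_k,\qquad \phi(B_k)=2D_k . \] Moreover, for every $k\ge 2$, \[ 2A_k=A_{k-1},\quad 2B_k=B_{k-1},\quad 2C_k=C_{k-1},\quad 2D_k=D_{k-1}. \] -/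

import Mathlib

namespace SomosFive

/-- The curve `E : y² + xy = x³ + x² - 2x` over `ℂ`. -/
def E : WeierstrassCurve ℂ := ⟨1, 1, 0, -2, 0⟩

/-- The curve `E' : y² + xy = x³ + x² + 8x + 10` over `ℂ`. -/
def E' : WeierstrassCurve ℂ := ⟨1, 1, 0, 8, 10⟩

instance : E.IsElliptic := by
  rw [WeierstrassCurve.isElliptic_iff, isUnit_iff_ne_zero]
  norm_num [E, WeierstrassCurve.Δ, WeierstrassCurve.b₂, WeierstrassCurve.b₄,
    WeierstrassCurve.b₆, WeierstrassCurve.b₈]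

instance : E'.IsElliptic := by
  rw [WeierstrassCurve.isElliptic_iff, isUnit_iff_ne_zero]
  norm_num [E', WeierstrassCurve.Δ, WeierstrassCurve.b₂, WeierstrassCurve.b₄,
    WeierstrassCurve.b₆, WeierstrassCurve.b₈]

theorem phi_nonsingular {x y : ℂ} (h : E.toAffine.Nonsingular x y) (hx : x ≠ 0) :
    E'.toAffine.Nonsingular ((x ^ 2 - 2) / x) ((x ^ 2 * y + 2 * x + 2 * y) / x ^ 2) := by
  rw [← WeierstrassCurve.Affine.equation_iff_nonsingular,
    WeierstrassCurve.Affine.equation_iff] at h ⊢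
  simp only [E, E', WeierstrassCurve.toAffine] at h ⊢
  field_simp
  linear_combination (x ^ 2 + 2) ^ 2 * h

/-- The map `φ : E(ℂ) → E'(ℂ)` underlying the `2`-isogeny
`φ(x, y) = ((x² - 2) / x, (x² y + 2 x + 2 y) / x²)`. The point at infinity and the only point of `E`
with `x = 0`, namely `(0, 0)`, are sent to the point at infinity. -/
noncomputable def phi : E.toAffine.Point → E'.toAffine.Point
  | .zero => 0
  | .some x y h =>
    if hx : x = 0 then 0
    else .some ((x ^ 2 - 2) / x) ((x ^ 2 * y + 2 * x + 2 * y) / x ^ 2) (phi_nonsingular h hx)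

/-- `(P, Q)` is a basis of the `n`-torsion `G[n]`, as a `ℤ/nℤ`-module: `P` and `Q` generate `G[n]`,
and they are independent modulo `n`. -/
def IsTorsionBasis {G : Type*} [AddCommGroup G] (n : ℕ) (P Q : G) : Prop :=
  AddSubgroup.closure {P, Q} = AddSubgroup.torsionBy G (n : ℤ) ∧
    ∀ a b : ℤ, a • P + b • Q = 0 → (n : ℤ) ∣ a ∧ (n : ℤ) ∣ b

end SomosFive

/-!
The proof is algebraic and avoids both the analytic uniformisation and the dual isogeny.

The map `φ` is a homomorphism (`phi_add`). Generically this holds because `φ` sends the points of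
`E` on a line `y = l x + m` to the points of `E'` on the line of slope `l + 2 / m`, and the
symmetric functions of the abscissas match (`phi_add_some_of_mul_ne`). The line is vertical
only when the sum of the two points is `0`, and `m = 0` only when one of the points is `T = (0, 0)`
or the abscissas satisfy `x₁ x₂ = -2`; the latter case is reduced to points of equal abscissa by the
invariance of `φ` under translation by `T` (`phi_add_T`).

The kernel of `φ` is `{0, T}`, `φ` is surjective, and every point of `E` can be halved
(`phi_surjective`, `exists_add_self_eq`), the equations for the abscissas being solvable over `ℂ`.
The points of order two of `E` other than `T` all have the same image under `φ`
(`phi_eq_of_add_self_eq_zero`), so any such point `S` gives a basis `S, T` of `E[2]`. If `2 W = T`,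
then `φ(S), φ(W)` is a basis of `E'[2]` (`isTorsionBasis_two_target`).

Now let `A` and `B` be chains of successive halves starting at `S` and `T`, and put `C k = φ(A k)`
and `D k = φ(B (k + 1))`. Then `φ(B k) = 2 D k`, and a chain of halves that starts at a basis of
the `2`-torsion consists of bases of the `2 ^ k`-torsion (`isTorsionBasis_of_halving`).
-/

namespace SomosFive

open WeierstrassCurve.Affine

/-! ### Explicit formulas for the two curves -/

theorem E_equation_iff {x y : ℂ} :
    E.toAffine.Equation x y ↔ y ^ 2 + x * y = x ^ 3 + x ^ 2 - 2 * x := by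
  rw [equation_iff]
  simp only [E, WeierstrassCurve.toAffine]
  constructor <;> intro h <;> linear_combination h

theorem E'_equation_iff {x y : ℂ} :
    E'.toAffine.Equation x y ↔ y ^ 2 + x * y = x ^ 3 + x ^ 2 + 8 * x + 10 := by
  rw [equation_iff]
  simp only [E', WeierstrassCurve.toAffine]
  constructor <;> intro h <;> linear_combination h

theorem E_negY (x y : ℂ) : E.toAffine.negY x y = -y - x := by
  simp [negY, E, WeierstrassCurve.toAffine]

theorem E'_negY (x y : ℂ) : E'.toAffine.negY x y = -y - x := by
  simp [negY, E', WeierstrassCurve.toAffine]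

theorem E_some_congr {x y x' y' : ℂ} (h : E.toAffine.Nonsingular x y) (hx : x = x') (hy : y = y') :
    Point.some x y h = Point.some x' y' (hx ▸ hy ▸ h) := by
  subst hx hy; rfl

theorem E'_some_congr {x y x' y' : ℂ} (h : E'.toAffine.Nonsingular x y) (hx : x = x')
    (hy : y = y') : Point.some x y h = Point.some x' y' (hx ▸ hy ▸ h) := by
  subst hx hy; rfl

/-- The sum of two points of `E`, in terms of the line `y = l x + m` through them. The abscissas of
the three intersection points are the roots of
`x³ + (1 - l² - l) x² - (2 + 2 l m + m) x - m²`, whose coefficients give the symmetric functions. -/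
theorem E_add_eq {x₁ y₁ x₂ y₂ : ℂ} (h₁ : E.toAffine.Nonsingular x₁ y₁)
    (h₂ : E.toAffine.Nonsingular x₂ y₂) (hxy : ¬(x₁ = x₂ ∧ y₁ = -y₂ - x₂)) :
    ∃ (l m x₃ y₃ : ℂ) (h₃ : E.toAffine.Nonsingular x₃ y₃),
      Point.some x₁ y₁ h₁ + Point.some x₂ y₂ h₂ = Point.some x₃ y₃ h₃ ∧
      y₁ = l * x₁ + m ∧ y₂ = l * x₂ + m ∧ y₃ = -(l * x₃ + m) - x₃ ∧
      x₁ + x₂ + x₃ = l ^ 2 + l - 1 ∧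
      x₁ * x₂ + x₁ * x₃ + x₂ * x₃ = -2 - 2 * l * m - m ∧
      x₁ * x₂ * x₃ = m ^ 2 ∧
      (x₁ = x₂ → l * (2 * y₁ + x₁) = 3 * x₁ ^ 2 + 2 * x₁ - 2 - y₁) := by
  have hxy' : ¬(x₁ = x₂ ∧ y₁ = E.toAffine.negY x₂ y₂) := by rwa [E_negY]
  have e₁ := E_equation_iff.1 h₁.1
  have e₂ := E_equation_iff.1 h₂.1
  set l := E.toAffine.slope x₁ x₂ y₁ y₂ with hl
  refine ⟨l, y₁ - l * x₁, _, _, nonsingular_add h₁ h₂ hxy', Point.add_some hxy', ?_⟩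
  have hX : E.toAffine.addX x₁ x₂ l = l ^ 2 + l - 1 - x₁ - x₂ := by
    simp [addX, E, WeierstrassCurve.toAffine]
  rw [← hl, addY, negAddY, E_negY, hX]
  by_cases hx : x₁ = x₂
  · subst hx
    have hy : y₁ ≠ -y₂ - x₁ := fun h => hxy ⟨rfl, h⟩
    have hyy : y₁ = y₂ := Y_eq_of_Y_ne h₁.1 h₂.1 rfl (by rwa [E_negY])
    subst hyy
    have hd : 2 * y₁ + x₁ ≠ 0 := fun h => hy (by linear_combination h)
    have hl' : l * (2 * y₁ + x₁) = 3 * x₁ ^ 2 + 2 * x₁ - 2 - y₁ := by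
      rw [hl, slope_of_Y_ne rfl (by rwa [E_negY]), E_negY]
      simp only [E, WeierstrassCurve.toAffine]
      rw [div_mul_eq_mul_div, div_eq_iff (by intro h; apply hd; linear_combination h)]
      ring
    refine ⟨by ring, by ring, by ring, by ring, ?_, ?_, fun _ => hl'⟩
    · linear_combination hl'
    · linear_combination -e₁ + x₁ * hl'
  · have hd : x₁ - x₂ ≠ 0 := sub_ne_zero.2 hx
    have hl' : l * (x₁ - x₂) = y₁ - y₂ := by
      rw [hl, slope_of_X_ne hx, div_mul_cancel₀ _ hd]
    have hy₂ : y₂ = y₁ - l * (x₁ - x₂) := by linear_combination hl'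
    clear_value l
    subst hy₂
    -- The difference of the equations of the two points is divisible by `x₁ - x₂`.
    have key : x₁ * x₂ + x₁ * (l ^ 2 + l - 1 - x₁ - x₂) + x₂ * (l ^ 2 + l - 1 - x₁ - x₂) =
        -2 - 2 * l * (y₁ - l * x₁) - (y₁ - l * x₁) := by
      apply mul_left_cancel₀ hd
      linear_combination e₁ - e₂
    refine ⟨by ring, by ring, by ring, by ring, key, ?_, fun h => absurd h hx⟩
    linear_combination -e₁ + x₁ * key

/-- The intercept `m` of the tangent `y = l x + m` to `E` at `(x, y)`, with denominators cleared. -/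
theorem tangent_intercept_mul {x y l m : ℂ} (q : y ^ 2 + x * y = x ^ 3 + x ^ 2 - 2 * x)
    (hy : y = l * x + m) (ht : l * (2 * y + x) = 3 * x ^ 2 + 2 * x - 2 - y) :
    m * (2 * y + x) = -x * (x ^ 2 + 2) := by
  linear_combination 2 * q - x * ht - (2 * y + x) * hy

/-- The sum of two points of `E'` on the line `y = l x + m`, which has to be the tangent if the
points coincide. -/
theorem E'_add_eq {x₁ y₁ x₂ y₂ l m : ℂ} (h₁ : E'.toAffine.Nonsingular x₁ y₁)
    (h₂ : E'.toAffine.Nonsingular x₂ y₂) (hy₁ : y₁ = l * x₁ + m) (hy₂ : y₂ = l * x₂ + m)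
    (hx : x₁ = x₂ → 2 * y₁ + x₁ ≠ 0 ∧
      l * (2 * y₁ + x₁) = 3 * x₁ ^ 2 + 2 * x₁ + 8 - y₁) :
    ∃ h₃, Point.some x₁ y₁ h₁ + Point.some x₂ y₂ h₂ =
      Point.some (W' := E'.toAffine) (l ^ 2 + l - 1 - x₁ - x₂)
        (-(l * (l ^ 2 + l - 1 - x₁ - x₂) + m) - (l ^ 2 + l - 1 - x₁ - x₂)) h₃ := by
  have hxy : ¬(x₁ = x₂ ∧ y₁ = E'.toAffine.negY x₂ y₂) := by
    rw [E'_negY]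
    rintro ⟨rfl, h⟩
    exact (hx rfl).1 (by linear_combination h + hy₁ - hy₂)
  have hl : E'.toAffine.slope x₁ x₂ y₁ y₂ = l := by
    by_cases h : x₁ = x₂
    · obtain ⟨hd, hl⟩ := hx h
      rw [slope_of_Y_ne h fun h' => hxy ⟨h, h'⟩, E'_negY]
      simp only [E', WeierstrassCurve.toAffine]
      rw [div_eq_iff (by intro h; apply hd; linear_combination h)]
      linear_combination -hl
    · rw [slope_of_X_ne h, div_eq_iff (sub_ne_zero.2 h)]
      linear_combination hy₁ - hy₂
  have hX : E'.toAffine.addX x₁ x₂ l = l ^ 2 + l - 1 - x₁ - x₂ := by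
    simp [addX, E', WeierstrassCurve.toAffine]
  have hY : E'.toAffine.addY x₁ x₂ y₁ l =
      -(l * (l ^ 2 + l - 1 - x₁ - x₂) + m) - (l ^ 2 + l - 1 - x₁ - x₂) := by
    rw [addY, negAddY, E'_negY, hX]
    linear_combination -hy₁
  have h₃ := nonsingular_add h₁ h₂ hxy
  rw [hl, hX, hY] at h₃
  refine ⟨h₃, ?_⟩
  rw [Point.add_some hxy]
  exact E'_some_congr _ (by rw [hl, hX]) (by rw [hl, hY])

/-! ### The map `φ` and translation by the point `(0, 0)` -/

theorem phi_zero : phi 0 = 0 := rfl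

theorem phi_some_of_ne {x y : ℂ} (h : E.toAffine.Nonsingular x y) (hx : x ≠ 0) :
    phi (.some x y h) = .some ((x ^ 2 - 2) / x) ((x ^ 2 * y + 2 * x + 2 * y) / x ^ 2)
      (phi_nonsingular h hx) := by
  simp [phi, hx]

theorem phi_some_of_eq {x y : ℂ} (h : E.toAffine.Nonsingular x y) (hx : x = 0) :
    phi (.some x y h) = 0 := by
  simp [phi, hx]

/-- The point `(0, 0)`, which generates the kernel of `φ`. -/
noncomputable def T : E.toAffine.Point :=
  .some 0 0 (equation_iff_nonsingular.1 (E_equation_iff.2 (by ring)))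

theorem eq_T_of_x_eq_zero {x y : ℂ} (h : E.toAffine.Nonsingular x y) (hx : x = 0) :
    Point.some x y h = T := by
  subst hx
  have := E_equation_iff.1 h.1
  exact E_some_congr _ rfl (by simpa using this)

theorem T_ne_zero : T ≠ 0 := Point.some_ne_zero _

theorem T_add_T : T + T = 0 := Point.add_of_Y_eq rfl (by rw [E_negY]; ring)

theorem phi_T : phi T = 0 := phi_some_of_eq _ rfl

theorem phi_eq_zero_iff {P : E.toAffine.Point} : phi P = 0 ↔ P = 0 ∨ P = T := by
  constructor
  · rcases P with _ | ⟨x, y, h⟩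
    · exact fun _ => Or.inl rfl
    · by_cases hx : x = 0
      · exact fun _ => Or.inr (eq_T_of_x_eq_zero h hx)
      · rw [phi_some_of_ne h hx]
        exact fun h' => absurd h' (Point.some_ne_zero _)
  · rintro (rfl | rfl)
    exacts [phi_zero, phi_T]

/-- Translation by `(0, 0)`: the abscissas `x` and `-2 / x` have the same image under
`x ↦ (x² - 2) / x`. -/
theorem some_add_T {x y : ℂ} (h : E.toAffine.Nonsingular x y) (hx : x ≠ 0) :
    ∃ h', Point.some x y h + T =
      Point.some (W' := E.toAffine) (-2 / x) ((2 * y + 2 * x) / x ^ 2) h' := by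
  obtain ⟨l, m, x₃, y₃, h₃, hs, hy₁, hy₂, hy₃, e₁, e₂, e₃, -⟩ :=
    E_add_eq h (equation_iff_nonsingular.1 (E_equation_iff.2 (by ring)) :
      E.toAffine.Nonsingular 0 0) (fun H => hx H.1)
  have hm : m = 0 := by simpa using hy₂.symm
  subst hm
  have hx₃ : x₃ = -2 / x := by
    rw [eq_div_iff hx]; linear_combination e₂
  have hl : l = y / x := by rw [eq_div_iff hx]; linear_combination -hy₁
  have hy : y₃ = (2 * y + 2 * x) / x ^ 2 := by
    rw [hy₃, hx₃, hl]; field_simp; ring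
  refine ⟨hx₃ ▸ hy ▸ h₃, ?_⟩
  exact hs.trans (E_some_congr _ hx₃ hy)

theorem phi_add_T (P : E.toAffine.Point) : phi (P + T) = phi P := by
  rcases P with _ | ⟨x, y, h⟩
  · change phi (0 + T) = phi 0
    rw [zero_add, phi_T, phi_zero]
  · by_cases hx : x = 0
    · rw [eq_T_of_x_eq_zero h hx, T_add_T, phi_T, phi_zero]
    · obtain ⟨h', e⟩ := some_add_T h hx
      rw [e, phi_some_of_ne h hx, phi_some_of_ne h' (div_ne_zero (by norm_num) hx)]
      apply E'_some_congr
      · field_simp; ring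
      · field_simp; ring

/-! ### Additivity of `φ` -/

theorem phi_neg (P : E.toAffine.Point) : phi (-P) = -phi P := by
  rcases P with _ | ⟨x, y, h⟩
  · rfl
  · rw [Point.neg_some]
    by_cases hx : x = 0
    · rw [phi_some_of_eq _ hx, phi_some_of_eq _ hx, neg_zero]
    · rw [phi_some_of_ne _ hx, phi_some_of_ne _ hx, Point.neg_some]
      apply E'_some_congr _ rfl
      rw [E_negY, E'_negY]
      field_simp
      ring

/-- Additivity of `φ` in the generic case, tangents included. The hypotheses say that the line
through the two points has an equation `y = l x + m` with `m ≠ 0`; `φ` sends its three intersection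
points with `E` to points of `E'` on the line
`y = (l + 2 / m) x + (m + 2 (1 - l² - l) / m)`. -/
theorem phi_add_some_of_mul_ne {x₁ y₁ x₂ y₂ : ℂ} (h₁ : E.toAffine.Nonsingular x₁ y₁)
    (h₂ : E.toAffine.Nonsingular x₂ y₂) (hx₁ : x₁ ≠ 0) (hx₂ : x₂ ≠ 0) (hx : x₁ * x₂ ≠ -2)
    (hxy : ¬(x₁ = x₂ ∧ y₁ = -y₂ - x₂)) :
    phi (.some x₁ y₁ h₁ + .some x₂ y₂ h₂) = phi (.some x₁ y₁ h₁) + phi (.some x₂ y₂ h₂) := by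
  obtain ⟨l, m, x₃, y₃, h₃, hs, hy₁, hy₂, hy₃, e₁, e₂, e₃, ht⟩ := E_add_eq h₁ h₂ hxy
  have hx₃ : x₃ ≠ 0 := by
    rintro rfl
    have hm : m = 0 := by simpa using e₃.symm
    subst hm
    exact hx (by linear_combination e₂)
  have hm : m ≠ 0 := by
    rintro rfl
    simp [hx₁, hx₂, hx₃] at e₃
  have q₁ := E_equation_iff.1 h₁.1
  have q₂ := E_equation_iff.1 h₂.1
  have q₃ := E_equation_iff.1 h₃.1
  have line : ∀ x y : ℂ, x ≠ 0 → y = l * x + m → y ^ 2 + x * y = x ^ 3 + x ^ 2 - 2 * x →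
      (x ^ 2 * y + 2 * x + 2 * y) / x ^ 2 =
        (l + 2 / m) * ((x ^ 2 - 2) / x) + (m + 2 / m * (1 - l ^ 2 - l)) := by
    rintro x y h0 rfl q
    field_simp
    linear_combination 2 * q
  rw [hs, phi_some_of_ne h₁ hx₁, phi_some_of_ne h₂ hx₂, phi_some_of_ne h₃ hx₃]
  obtain ⟨h', e⟩ := E'_add_eq (phi_nonsingular h₁ hx₁) (phi_nonsingular h₂ hx₂)
    (line x₁ y₁ hx₁ hy₁ q₁) (line x₂ y₂ hx₂ hy₂ q₂) (by
      intro hX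
      have hxx : x₁ = x₂ := by
        rw [div_eq_div_iff hx₁ hx₂] at hX
        have : (x₁ - x₂) * (x₁ * x₂ + 2) = 0 := by linear_combination hX
        rcases mul_eq_zero.1 this with h | h
        · exact sub_eq_zero.1 h
        · exact absurd (eq_neg_of_add_eq_zero_left h) hx
      subst hxx
      have hyy : y₁ = y₂ := by rw [hy₁, hy₂]
      subst hyy
      have hd : 2 * y₁ + x₁ ≠ 0 := fun h => hxy ⟨rfl, by linear_combination h⟩
      have hd' : x₁ ^ 2 + 2 ≠ 0 := fun h => hx (by linear_combination h)
      have hY : 2 * ((x₁ ^ 2 * y₁ + 2 * x₁ + 2 * y₁) / x₁ ^ 2) + (x₁ ^ 2 - 2) / x₁ =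
          (2 * y₁ + x₁) * (x₁ ^ 2 + 2) / x₁ ^ 2 := by
        field_simp; ring
      -- It remains to see that the image of the tangent to `E` is the tangent to `E'`.
      refine ⟨?_, ?_⟩
      · rw [hY]
        exact div_ne_zero (mul_ne_zero hd hd') (pow_ne_zero _ hx₁)
      · rw [hY]
        have ht := ht rfl
        have hmd : m * (2 * y₁ + x₁) = -x₁ * (x₁ ^ 2 + 2) :=
          tangent_intercept_mul q₁ hy₁ ht
        have hsq : (2 * y₁ + x₁) ^ 2 = 4 * x₁ ^ 3 + 5 * x₁ ^ 2 - 8 * x₁ := by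
          linear_combination 4 * q₁
        have hr : 2 * (2 * y₁ + x₁) * (x₁ ^ 2 + 2) + m * (8 * x₁ ^ 2 + 10 * x₁ - 16) = 0 := by
          apply mul_left_cancel₀ hd
          linear_combination 2 * (x₁ ^ 2 + 2) * hsq + (8 * x₁ ^ 2 + 10 * x₁ - 16) * hmd
        clear line hY
        field_simp
        linear_combination m * (x₁ ^ 2 + 2) * ht + hr)
  rw [e]
  have hX : (x₃ ^ 2 - 2) / x₃ = (l + 2 / m) ^ 2 + (l + 2 / m) - 1 - (x₁ ^ 2 - 2) / x₁ -
      (x₂ ^ 2 - 2) / x₂ := by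
    -- `∑ (xᵢ - 2 / xᵢ)` in terms of the elementary symmetric functions of the `xᵢ`.
    have : (x₁ ^ 2 - 2) / x₁ + (x₂ ^ 2 - 2) / x₂ + (x₃ ^ 2 - 2) / x₃ = (x₁ + x₂ + x₃) -
        2 * (x₁ * x₂ + x₁ * x₃ + x₂ * x₃) / (x₁ * x₂ * x₃) := by
      field_simp; ring
    rw [e₁, e₂, e₃] at this
    have h2 : (l ^ 2 + l - 1) - 2 * (-2 - 2 * l * m - m) / m ^ 2 =
        (l + 2 / m) ^ 2 + (l + 2 / m) - 1 := by field_simp; ring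
    linear_combination this + h2
  refine E'_some_congr _ hX ?_
  rw [← hX, ← line x₃ (l * x₃ + m) hx₃ rfl (by rw [hy₃] at q₃; linear_combination q₃), hy₃]
  field_simp
  ring

theorem add_self_eq_zero_iff {x y : ℂ} (h : E.toAffine.Nonsingular x y) :
    Point.some x y h + Point.some x y h = 0 ↔ 2 * y + x = 0 := by
  rw [add_eq_zero_iff_eq_neg, Point.neg_some, Point.some.injEq, E_negY]
  constructor
  · rintro ⟨-, h⟩; linear_combination h
  · intro h; exact ⟨rfl, by linear_combination h⟩

/-- If `x₁ x₂ = -2`, then translation by `T` reduces a sum of points with abscissas `x₁` and `x₂`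
to a sum of points with the same abscissa. -/
theorem some_add_T_eq_or_eq_neg {x₁ y₁ x₂ y₂ : ℂ} (h₁ : E.toAffine.Nonsingular x₁ y₁)
    (h₂ : E.toAffine.Nonsingular x₂ y₂) (hx : x₁ * x₂ = -2) :
    Point.some x₂ y₂ h₂ + T = Point.some x₁ y₁ h₁ ∨
      Point.some x₂ y₂ h₂ + T = -Point.some x₁ y₁ h₁ := by
  have hx₂ : x₂ ≠ 0 := by rintro rfl; norm_num at hx
  obtain ⟨h', e⟩ := some_add_T h₂ hx₂
  rw [e]
  exact Point.X_eq_iff.1 (by rw [div_eq_iff hx₂, hx])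

theorem phi_add_self (P : E.toAffine.Point) : phi (P + P) = phi P + phi P := by
  -- If `2 P` is `0` or `T`, then both sides vanish, as `φ(P) = φ(-P)`.
  have key : ∀ Q, phi Q = 0 → P + P = Q → phi P = -phi P → phi (P + P) = phi P + phi P := by
    intro Q hQ hP h
    rw [hP, hQ, eq_comm, add_eq_zero_iff_eq_neg]
    exact h
  by_cases h2 : P + P = 0
  · refine key 0 phi_zero h2 ?_
    rw [← phi_neg, ← add_eq_zero_iff_eq_neg.1 h2]
  rcases P with _ | ⟨x, y, h⟩
  · exact absurd (add_zero (0 : E.toAffine.Point)) h2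
  have hx : x ≠ 0 := fun hx => h2 (by rw [eq_T_of_x_eq_zero h hx, T_add_T])
  by_cases hxx : x * x = -2
  · rcases some_add_T_eq_or_eq_neg h h hxx with e | e
    · exact absurd (add_eq_left.1 e) T_ne_zero
    · refine key T phi_T ?_ ?_
      · calc Point.some x y h + Point.some x y h
            = Point.some x y h - -Point.some x y h := by abel
          _ = -T := by rw [← e]; abel
          _ = T := (add_eq_zero_iff_neg_eq.1 T_add_T)
      · rw [← phi_neg, ← e, phi_add_T]
  · refine phi_add_some_of_mul_ne h h hx hx hxx fun h' => h2 ?_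
    rw [add_self_eq_zero_iff]
    linear_combination h'.2

theorem phi_add (P Q : E.toAffine.Point) : phi (P + Q) = phi P + phi Q := by
  rcases P with _ | ⟨x₁, y₁, h₁⟩
  · change phi (0 + Q) = phi 0 + phi Q
    rw [phi_zero, zero_add, zero_add]
  rcases Q with _ | ⟨x₂, y₂, h₂⟩
  · change phi (_ + 0) = _ + phi 0
    rw [phi_zero, add_zero, add_zero]
  by_cases hx₁ : x₁ = 0
  · rw [eq_T_of_x_eq_zero h₁ hx₁, add_comm, phi_add_T, phi_T, zero_add]
  by_cases hx₂ : x₂ = 0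
  · rw [eq_T_of_x_eq_zero h₂ hx₂, phi_add_T, phi_T, add_zero]
  by_cases hx : x₁ * x₂ = -2
  · rw [← phi_add_T, ← phi_add_T (.some x₂ y₂ h₂), add_assoc]
    rcases some_add_T_eq_or_eq_neg h₁ h₂ hx with e | e
    · rw [e, phi_add_self]
    · rw [e, add_neg_cancel, phi_neg, add_neg_cancel, phi_zero]
  by_cases hxy : x₁ = x₂ ∧ y₁ = -y₂ - x₂
  · have e : Point.some x₁ y₁ h₁ = -Point.some x₂ y₂ h₂ := by
      rw [Point.neg_some]
      exact E_some_congr _ hxy.1 (by rw [E_negY, hxy.2])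
    rw [e, neg_add_cancel, phi_neg, neg_add_cancel, phi_zero]
  · exact phi_add_some_of_mul_ne h₁ h₂ hx₁ hx₂ hx hxy

/-- The isogeny `φ` as a homomorphism of groups. -/
noncomputable def phiHom : E.toAffine.Point →+ E'.toAffine.Point where
  toFun := phi
  map_zero' := phi_zero
  map_add' := phi_add

/-! ### Surjectivity and points of order two -/

theorem exists_quadratic_root (b c : ℂ) : ∃ z : ℂ, z ^ 2 + b * z + c = 0 := by
  obtain ⟨s, hs⟩ := IsAlgClosed.exists_pow_nat_eq (b ^ 2 - 4 * c) (n := 2) two_pos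
  exact ⟨(s - b) / 2, by linear_combination hs / 4⟩

theorem exists_nonsingular (x : ℂ) : ∃ y, E.toAffine.Nonsingular x y := by
  obtain ⟨y, hy⟩ := exists_quadratic_root x (-(x ^ 3 + x ^ 2 - 2 * x))
  exact ⟨y, equation_iff_nonsingular.1 (E_equation_iff.2 (by linear_combination hy))⟩

theorem exists_sq_sub_two_div (u : ℂ) : ∃ x : ℂ, x ≠ 0 ∧ (x ^ 2 - 2) / x = u := by
  obtain ⟨x, hx⟩ := exists_quadratic_root (-u) (-2)
  have h0 : x ≠ 0 := by rintro rfl; norm_num at hx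
  exact ⟨x, h0, by rw [div_eq_iff h0]; linear_combination hx⟩

theorem phi_surjective : Function.Surjective phi := by
  rintro (_ | ⟨X, Y, h⟩)
  · exact ⟨0, rfl⟩
  obtain ⟨x, hx, hX⟩ := exists_sq_sub_two_div X
  obtain ⟨y, hy⟩ := exists_nonsingular x
  have e := phi_some_of_ne hy hx
  rcases Point.X_eq_iff (h₁ := phi_nonsingular hy hx) (h₂ := h) |>.1 hX with h' | h'
  · exact ⟨_, e.trans h'⟩
  · exact ⟨-.some x y hy, by rw [phi_neg, e, h', neg_neg]⟩

/-- Every point of `E(ℂ)` can be halved. The abscissa `x` of a half of a point of abscissa `X`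
satisfies `(x² + 2)² = X x (4 x² + 5 x - 8)`, that is, `u² + 8 = X (4 u + 5)` for `u = x - 2 / x`. -/
theorem exists_add_self_eq (P : E.toAffine.Point) : ∃ Q, Q + Q = P := by
  rcases P with _ | ⟨X, Y, h⟩
  · exact ⟨0, add_zero _⟩
  obtain ⟨u, hu⟩ := exists_quadratic_root (-4 * X) (8 - 5 * X)
  obtain ⟨x, hx, rfl⟩ := exists_sq_sub_two_div u
  obtain ⟨y, hy⟩ := exists_nonsingular x
  have q := E_equation_iff.1 hy.1
  -- `u² + 8 = ((x² + 2) / x)²`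
  have hX : (x ^ 2 + 2) ^ 2 = X * (x * (4 * x ^ 2 + 5 * x - 8)) := by
    field_simp at hu
    linear_combination hu
  have hsq : (2 * y + x) ^ 2 = x * (4 * x ^ 2 + 5 * x - 8) := by
    linear_combination 4 * q
  have hd : 2 * y + x ≠ 0 := by
    intro h0
    have h1 : x * (4 * x ^ 2 + 5 * x - 8) = 0 := by rw [← hsq, h0]; ring
    have h2 : x ^ 2 + 2 = 0 := by
      rw [h1, mul_zero] at hX
      exact pow_eq_zero_iff two_ne_zero |>.1 hX
    have h3 : 4 * x ^ 2 + 5 * x - 8 = 0 := (mul_eq_zero.1 h1).resolve_left hx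
    have h4 : x = 16 / 5 := by linear_combination h3 / 5 - 4 / 5 * h2
    rw [h4] at h2
    norm_num at h2
  obtain ⟨l, m, x₃, y₃, h₃, hs, hy₁, -, -, -, -, e₃, ht⟩ :=
    E_add_eq hy hy fun h' => hd (by linear_combination h'.2)
  have hmd : m * (2 * y + x) = -x * (x ^ 2 + 2) :=
    tangent_intercept_mul q hy₁ (ht rfl)
  have hx₃ : x₃ = X := by
    apply mul_left_cancel₀ (mul_ne_zero (pow_ne_zero 2 hx) (pow_ne_zero 2 hd))
    linear_combination (2 * y + x) ^ 2 * e₃ + (m * (2 * y + x) - x * (x ^ 2 + 2)) * hmd +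
      x ^ 2 * hX - x ^ 2 * X * hsq
  -- Equal abscissas determine the double up to sign, which is corrected by negating the half.
  rcases Point.X_eq_iff (h₁ := h₃) (h₂ := h) |>.1 hx₃ with h' | h'
  · exact ⟨_, hs.trans h'⟩
  · refine ⟨-.some x y hy, ?_⟩
    rw [← neg_add, hs, h', neg_neg]

/-- `φ` maps the two points of order `2` other than `(0, 0)` to the same point: their abscissas are
the roots of `4 x² + 5 x - 8`, that is, the solutions of `x - 2 / x = -5 / 4`. -/
theorem phi_eq_of_add_self_eq_zero {P : E.toAffine.Point} (h2 : P + P = 0) (h0 : P ≠ 0)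
    (hT : P ≠ T) : ∃ h, phi P = .some (-5 / 4) (5 / 8) h := by
  rcases P with _ | ⟨x, y, h⟩
  · exact absurd rfl h0
  have hx : x ≠ 0 := fun hx => hT (eq_T_of_x_eq_zero h hx)
  have hy := (add_self_eq_zero_iff h).1 h2
  have q := E_equation_iff.1 h.1
  obtain rfl : x = -2 * y := by linear_combination hy
  have hy0 : y ≠ 0 := by rintro rfl; simp at hx
  have q' : 8 * y ^ 2 - 5 * y - 4 = 0 := by
    apply mul_left_cancel₀ hy0
    linear_combination q
  have hX : ((-2 * y) ^ 2 - 2) / (-2 * y) = -5 / 4 := by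
    field_simp; linear_combination -q'
  have hY : ((-2 * y) ^ 2 * y + 2 * (-2 * y) + 2 * y) / (-2 * y) ^ 2 = 5 / 8 := by
    field_simp; linear_combination 2 * q'
  exact ⟨_, (phi_some_of_ne h hx).trans (E'_some_congr _ hX hY)⟩

theorem exists_add_self_eq_zero : ∃ S : E.toAffine.Point, S + S = 0 ∧ S ≠ 0 ∧ S ≠ T := by
  obtain ⟨x, hx⟩ := exists_quadratic_root (5 / 4) (-2)
  have h0 : x ≠ 0 := by rintro rfl; norm_num at hx
  refine ⟨.some x (-x / 2) (equation_iff_nonsingular.1 (E_equation_iff.2 ?_)), ?_,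
    Point.some_ne_zero _, ?_⟩
  · linear_combination -x * hx
  · rw [add_self_eq_zero_iff]; ring
  · intro h
    exact h0 (Point.some.inj h).1

/-! ### Bases of the torsion and chains of halves -/

theorem isTorsionBasis_iff {G : Type*} [AddCommGroup G] {n : ℕ} {P Q : G} :
    IsTorsionBasis n P Q ↔ n • P = 0 ∧ n • Q = 0 ∧
      (∀ R : G, n • R = 0 → ∃ a b : ℤ, a • P + b • Q = R) ∧
      ∀ a b : ℤ, a • P + b • Q = 0 → (n : ℤ) ∣ a ∧ (n : ℤ) ∣ b := by
  have mem : ∀ R : G, R ∈ AddSubgroup.torsionBy G (n : ℤ) ↔ n • R = 0 := fun R => by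
    rw [← natCast_zsmul]; exact Iff.rfl
  rw [IsTorsionBasis, ← and_assoc, ← and_assoc]
  refine and_congr_left fun _ => ⟨fun h => ?_, fun ⟨⟨hP, hQ⟩, h⟩ => le_antisymm ?_ fun R hR => ?_⟩
  · refine ⟨⟨?_, ?_⟩, fun R hR => ?_⟩
    · rw [← mem, ← h]; exact AddSubgroup.subset_closure (by simp)
    · rw [← mem, ← h]; exact AddSubgroup.subset_closure (by simp)
    · rw [← mem, ← h] at hR; exact AddSubgroup.mem_closure_pair.1 hR
  · rw [AddSubgroup.closure_le]
    rintro _ (rfl | rfl)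
    exacts [(mem _).2 hP, (mem _).2 hQ]
  · exact AddSubgroup.mem_closure_pair.2 (h R ((mem R).1 hR))

/-- Halving both elements of a basis of `G[n]` gives a basis of `G[2n]`, provided that their
multiples by `n` form a basis of `G[2]`. -/
theorem IsTorsionBasis.halve {G : Type*} [AddCommGroup G] {n : ℕ} {P Q P₁ Q₁ : G}
    (h : IsTorsionBasis n (2 • P) (2 • Q)) (h₁ : IsTorsionBasis 2 P₁ Q₁)
    (hP : n • P = P₁) (hQ : n • Q = Q₁) : IsTorsionBasis (n * 2) P Q := by
  rw [isTorsionBasis_iff] at *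
  obtain ⟨nP, nQ, gen, ind⟩ := h
  obtain ⟨tP, tQ, gen₁, ind₁⟩ := h₁
  refine ⟨by rwa [mul_smul], by rwa [mul_smul], fun R hR => ?_, fun a b hab => ?_⟩
  · obtain ⟨a, b, e⟩ := gen (2 • R) (by rwa [← mul_smul])
    obtain ⟨c, d, e'⟩ := gen₁ (R - a • P - b • Q) (by
      rw [smul_sub, smul_sub, ← e, smul_comm a, smul_comm b]; abel)
    refine ⟨a + c * n, b + d * n, ?_⟩
    rw [← hP, ← hQ] at e'
    rw [add_smul, add_smul, mul_smul, mul_smul, natCast_zsmul, natCast_zsmul]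
    calc _ = a • P + b • Q + (c • n • P + d • n • Q) := by abel
      _ = R := by rw [e']; abel
  · obtain ⟨⟨a, rfl⟩, ⟨b, rfl⟩⟩ := ind₁ a b (by
      rw [← hP, ← hQ, smul_comm a, smul_comm b, ← smul_add, hab, smul_zero])
    obtain ⟨ha, hb⟩ := ind a b (by
      rw [← hab]; simp only [← natCast_zsmul, ← mul_smul]; push_cast
      rw [mul_comm a, mul_comm b])
    push_cast
    rw [mul_comm (n : ℤ)]
    exact ⟨mul_dvd_mul_left 2 ha, mul_dvd_mul_left 2 hb⟩

theorem pow_two_smul_of_halving {G : Type*} [AddCommGroup G] {P : ℕ → G}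
    (hP : ∀ k, 2 • P (k + 1) = P k) (k : ℕ) : 2 ^ k • P k = P 0 := by
  induction k with
  | zero => simp
  | succ k ih => rw [pow_succ, mul_smul, hP, ih]

theorem isTorsionBasis_of_halving {G : Type*} [AddCommGroup G] {P Q : ℕ → G}
    (h : IsTorsionBasis 2 (P 0) (Q 0)) (hP : ∀ k, 2 • P (k + 1) = P k)
    (hQ : ∀ k, 2 • Q (k + 1) = Q k) (k : ℕ) : IsTorsionBasis (2 ^ (k + 1)) (P k) (Q k) := by
  induction k with
  | zero => simpa using h
  | succ k ih =>
    rw [pow_succ]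
    refine IsTorsionBasis.halve (by rwa [hP, hQ]) h ?_ ?_
    · rw [pow_succ, mul_smul, hP, pow_two_smul_of_halving hP]
    · rw [pow_succ, mul_smul, hQ, pow_two_smul_of_halving hQ]

theorem exists_halving {G : Type*} [AddCommGroup G] (h : ∀ P : G, ∃ Q, Q + Q = P) (P₀ : G) :
    ∃ P : ℕ → G, P 0 = P₀ ∧ ∀ k, 2 • P (k + 1) = P k := by
  choose f hf using h
  refine ⟨fun k => f^[k] P₀, rfl, fun k => ?_⟩
  change 2 • f^[k + 1] P₀ = f^[k] P₀
  rw [Function.iterate_succ_apply', two_nsmul, hf]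

variable {G H : Type*} [AddCommGroup G] [AddCommGroup H]

theorem two_dvd_of_zsmul_eq_zero {T : G} (hT : 2 • T = 0) (h0 : T ≠ 0) {a : ℤ} (ha : a • T = 0) :
    (2 : ℤ) ∣ a := by
  rcases Int.even_or_odd' a with ⟨c, rfl | rfl⟩
  · exact dvd_mul_right 2 c
  · refine absurd ?_ h0
    rwa [add_smul, mul_comm, mul_smul, ofNat_zsmul, hT, smul_zero, zero_add, one_smul] at ha

/-- If `f` has kernel `{0, T}` and is constant on `G[2] \ {0, T}`, then `T` and any `S` in this set
form a basis of `G[2]`. -/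
theorem isTorsionBasis_two_source (f : G →+ H) {S T : G} (hT : 2 • T = 0) (hT0 : T ≠ 0)
    (hker : ∀ P, f P = 0 ↔ P = 0 ∨ P = T) (hS : 2 • S = 0) (hS0 : f S ≠ 0)
    (hconst : ∀ P, 2 • P = 0 → f P ≠ 0 → f P = f S) : IsTorsionBasis 2 S T := by
  have hfT : f T = 0 := (hker T).2 (Or.inr rfl)
  rw [isTorsionBasis_iff]
  refine ⟨hS, hT, fun R hR => ?_, fun a b hab => ?_⟩
  · by_cases h : f R = 0
    · rcases (hker R).1 h with rfl | rfl
      · exact ⟨0, 0, by simp⟩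
      · exact ⟨0, 1, by simp⟩
    · have : f (R - S) = 0 := by rw [map_sub, hconst R hR h, sub_self]
      rcases (hker _).1 this with e | e
      · exact ⟨1, 0, by rw [sub_eq_zero.1 e]; simp⟩
      · exact ⟨1, 1, by rw [← e]; simp⟩
  · have ha : (2 : ℤ) ∣ a := by
      refine two_dvd_of_zsmul_eq_zero (T := f S) (by rw [← map_nsmul, hS, map_zero]) hS0 ?_
      simpa [hfT] using congrArg f hab
    refine ⟨ha, two_dvd_of_zsmul_eq_zero hT hT0 ?_⟩
    obtain ⟨c, rfl⟩ := ha
    rwa [mul_comm, mul_smul, ofNat_zsmul, hS, smul_zero, zero_add] at hab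

/-- If `f` is surjective with kernel `{0, T}`, then a basis of `H[2]` is given by the images of a
complement of `T` in `G[2]` and of a half of `T`. -/
theorem isTorsionBasis_two_target (f : G →+ H) (hf : Function.Surjective f) {S T W : G}
    (hT0 : T ≠ 0) (hker : ∀ P, f P = 0 ↔ P = 0 ∨ P = T) (hST : IsTorsionBasis 2 S T)
    (hW : 2 • W = T) : IsTorsionBasis 2 (f S) (f W) := by
  have hfT : f T = 0 := (hker T).2 (Or.inr rfl)
  rw [isTorsionBasis_iff] at hST ⊢
  obtain ⟨hS, hT, gen, ind⟩ := hST
  refine ⟨by rw [← map_nsmul, hS, map_zero], by rw [← map_nsmul, hW, hfT], fun R hR => ?_,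
    fun a b hab => ?_⟩
  · obtain ⟨P, rfl⟩ := hf R
    rw [← map_nsmul] at hR
    rcases (hker _).1 hR with e | e
    · obtain ⟨a, b, rfl⟩ := gen P e
      exact ⟨a, 0, by simp [hfT]⟩
    · obtain ⟨a, b, h⟩ := gen (P - W) (by rw [smul_sub, e, hW, sub_self])
      refine ⟨a, 1, ?_⟩
      rw [← sub_add_cancel P W, ← h]
      simp [hfT]
  · have h : f (a • S + b • W) = 0 := by simpa using hab
    have h2 : 2 • (a • S + b • W) = 0 := by
      rcases (hker _).1 h with e | e <;> rw [e]
      exacts [smul_zero _, hT]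
    have hb : (2 : ℤ) ∣ b := by
      refine two_dvd_of_zsmul_eq_zero hT hT0 ?_
      rwa [smul_add, smul_comm, hS, smul_zero, zero_add, smul_comm, hW] at h2
    refine ⟨?_, hb⟩
    obtain ⟨c, rfl⟩ := hb
    rw [mul_comm, mul_smul, ofNat_zsmul, hW] at h
    rcases (hker _).1 h with e | e
    · exact (ind a c e).1
    · exact (ind a (c - 1) (by rw [sub_smul, one_smul, ← add_sub_assoc, e, sub_self])).1

end SomosFive

theorem mainTheorem9 :
    ∃ (A B : ℕ → SomosFive.E.toAffine.Point) (C D : ℕ → SomosFive.E'.toAffine.Point),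
      (∀ k : ℕ, 1 ≤ k →
        SomosFive.IsTorsionBasis (2 ^ k) (A k) (B k) ∧
        SomosFive.IsTorsionBasis (2 ^ k) (C k) (D k) ∧
        SomosFive.phi (A k) = C k ∧
        SomosFive.phi (B k) = 2 • D k) ∧
      (∀ k : ℕ, 2 ≤ k →
        2 • A k = A (k - 1) ∧
        2 • B k = B (k - 1) ∧
        2 • C k = C (k - 1) ∧
        2 • D k = D (k - 1)) := by
  open SomosFive in
  obtain ⟨S, hS, hS0, hST⟩ := exists_add_self_eq_zero
  have hker : ∀ P, phiHom P = 0 ↔ P = 0 ∨ P = T := fun P => phi_eq_zero_iff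
  have hne : ∀ P, phiHom P ≠ 0 → P ≠ 0 ∧ P ≠ T := fun P hP => by
    rwa [Ne, hker, not_or] at hP
  have hbasis : IsTorsionBasis 2 S T := by
    refine isTorsionBasis_two_source phiHom (by rw [two_nsmul, T_add_T]) T_ne_zero hker
      (by rw [two_nsmul, hS]) (by rw [Ne, hker, not_or]; exact ⟨hS0, hST⟩) fun P hP hP0 => ?_
    obtain ⟨_, e⟩ :=
      phi_eq_of_add_self_eq_zero (by rwa [two_nsmul] at hP) (hne P hP0).1 (hne P hP0).2
    obtain ⟨_, e'⟩ := phi_eq_of_add_self_eq_zero hS hS0 hST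
    exact e.trans e'.symm
  obtain ⟨A, hA0, hA⟩ := exists_halving exists_add_self_eq S
  obtain ⟨B, hB0, hB⟩ := exists_halving exists_add_self_eq T
  have hphi : ∀ P, phiHom (2 • P) = 2 • phiHom P := map_nsmul phiHom 2
  -- The chains are indexed from `0`, the bases in the statement from `1`; and `D k` is the image
  -- of a half of `B k`.
  refine ⟨fun k => A (k - 1), fun k => B (k - 1), fun k => phiHom (A (k - 1)),
    fun k => phiHom (B k), fun k hk => ?_, fun k hk => ?_⟩
  · obtain ⟨k, rfl⟩ := Nat.exists_eq_add_of_le' hk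
    simp only [Nat.add_sub_cancel]
    refine ⟨isTorsionBasis_of_halving (by rwa [hA0, hB0]) hA hB k,
      isTorsionBasis_of_halving (P := fun k => phiHom (A k)) (Q := fun k => phiHom (B (k + 1)))
        ?_ (fun k => ?_) (fun k => ?_) k, rfl, ?_⟩
    · simp only [hA0]
      exact isTorsionBasis_two_target phiHom phi_surjective T_ne_zero hker hbasis
        (by rw [hB, hB0])
    · simp only [← hphi, hA]
    · simp only [← hphi, hB]
    · rw [← hphi, hB]; rfl
  · obtain ⟨k, rfl⟩ := Nat.exists_eq_add_of_le' hk
    have e : k + 2 - 1 = k + 1 := rfl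
    simp only [e, Nat.add_sub_cancel, ← hphi, hA, hB, and_self]
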